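/- Let $n \ge 2$, let $\mathbb S^{n-1}\subset\mathbb R^n$ be the unit sphere with geodesic distance $d(x,y)=\arccos\langle x,y\rangle$, let $\sigma$ be the uniform (normalized surface) probability measure on $\mathbb S^{n-1}$, and let $p\in[1,\infty)$. For Borel probability measures $\mu,\nu$ on $\mathbb S^{n-1}$ put $$W_p(\mu,\nu)=\inf_{\pi\in\Pi(\mu,\nu)}\Big(\int d(x,y)^p\,d\pi(x,y)\Big)^{1/p},$$ where $\Pi(\mu,\nu)$ is the set of probability measures on $\mathbb S^{n-1}\times\mathbb S^{n-1}$ with marginals $\mu$ and $\nu$. Let $V:\mathbb S^{n-1}\times\mathbb S^{n-1}\to[0,\infty)$ be a measurable kernel that is zonal, i.e. $V(x,y)$ depends only on $\langle x,y\rangle$, and has unit mass, i.e. $\int V(x_0,x)\,d\sigma(x)=1$ for some (equivalently, every) $x_0\in\mathbb S^{n-1}$. For a probability measure $\mu$ let $V*\mu$ be the measure with density $x\mapsto\int V(x,y)\,d\mu(y)$ with respect to $\sigma$. Call $C_0>0$ admissible if for all $x,y\in\mathbb S^{n-1}$, every minimizing geodesic from $x$ to $y$, every $v_x\in T_x\mathbb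 S^{n-1}$ with parallel transport $v_y\in T_y\mathbb S^{n-1}$ along this geodesic, and all $t\ge 0$, $$d\big(\exp_x(tv_x),\exp_y(tv_y)\big)\le C_0\,d(x,y).$$ Then $C_0=3$ is admissible, and for every admissible constant $C_0$ (in particular for $C_0=3$) and all Borel probability measures $\mu,\nu$ on $\mathbb S^{n-1}$, $$W_p(V*\mu,V*\nu)\le C_0\,W_p(\mu,\nu).$$ -/

import Mathlib

open MeasureTheory Set
open scoped ENNReal RealInnerProductSpace

noncomputable section

/-- The unit sphere `𝕊ⁿ⁻¹ ⊆ ℝⁿ`. -/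
abbrev USphere (n : ℕ) : Type := Metric.sphere (0 : EuclideanSpace ℝ (Fin n)) 1

/-- The geodesic distance `d(x, y) = arccos ⟨x, y⟩`, used for points of the unit sphere. -/
def geoDist {n : ℕ} (x y : EuclideanSpace ℝ (Fin n)) : ℝ := Real.arccos ⟪x, y⟫

/-- The uniform probability measure on `𝕊ⁿ⁻¹`: the surface measure divided by its total mass. -/
def sphereUnif (n : ℕ) : Measure (USphere n) :=
  ((volume : Measure (EuclideanSpace ℝ (Fin n))).toSphere univ)⁻¹ •
    (volume : Measure (EuclideanSpace ℝ (Fin n))).toSphere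

/-- A kernel on the sphere is zonal if it depends only on the scalar product. -/
def IsZonal {n : ℕ} (V : USphere n → USphere n → ℝ) : Prop :=
  ∃ f : ℝ → ℝ, ∀ x y : USphere n,
    V x y = f ⟪(x : EuclideanSpace ℝ (Fin n)), (y : EuclideanSpace ℝ (Fin n))⟫

/-- The convolution `V * μ` of a non-negative kernel `V` with a measure `μ`, as a measure:
it has density `x ↦ ∫ V(x, y) dμ(y)` with respect to the uniform measure. -/
def sphereConv {n : ℕ} (V : USphere n → USphere n → ℝ) (μ : Measure (USphere n)) :
    Measure (USphere n) :=
  (sphereUnif n).withDensity fun x => ∫⁻ y, ENNReal.ofReal (V x y) ∂μ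

/-- `Π(μ, ν)`: the probability measures on the product with marginals `μ` and `ν`. -/
def couplings {n : ℕ} (μ ν : Measure (USphere n)) : Set (Measure (USphere n × USphere n)) :=
  {π | IsProbabilityMeasure π ∧ π.map Prod.fst = μ ∧ π.map Prod.snd = ν}

/-- The Wasserstein-`p` distance for the geodesic distance, with values in `[0, ∞]`
(it is `∞` if there is no coupling). -/
def wassersteinDist {n : ℕ} (p : ℝ) (μ ν : Measure (USphere n)) : ℝ≥0∞ :=
  ⨅ π ∈ couplings μ ν,
    (∫⁻ z, ENNReal.ofReal (geoDist (z.1 : EuclideanSpace ℝ (Fin n)) z.2) ^ p ∂π) ^ (1 / p)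

/-- The Riemannian exponential map of the unit sphere,
`exp_x v = cos ‖v‖ x + (sin ‖v‖ / ‖v‖) v`, for a point `x` and a tangent vector `v ⟂ x`. -/
def sphereExp {n : ℕ} (x v : EuclideanSpace ℝ (Fin n)) : EuclideanSpace ℝ (Fin n) :=
  Real.cos ‖v‖ • x + Real.sinc ‖v‖ • v

/-- `X` is a parallel vector field along the curve `γ : [0, 1] → 𝕊ⁿ⁻¹`: it is tangent to the
sphere, and its covariant derivative (the tangential part of the derivative) vanishes. -/
def IsParallelAlong {n : ℕ} (γ X : ℝ → EuclideanSpace ℝ (Fin n)) : Prop :=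
  ContinuousOn X (Icc 0 1) ∧
  (∀ s ∈ Icc (0 : ℝ) 1, ⟪γ s, X s⟫ = 0) ∧
  ∀ s ∈ Ioo (0 : ℝ) 1, DifferentiableAt ℝ X s ∧ deriv X s - ⟪γ s, deriv X s⟫ • γ s = 0

/-- `C` is an admissible constant in the comparison of geodesics with parallel initial velocities
on `𝕊ⁿ⁻¹`. Here `s ↦ exp_x (s w)`, with `‖w‖ ≤ π`, is a minimizing geodesic from `x` to
`y = exp_x w`, and `X 1` is the parallel transport of `X 0` along it. -/
def IsGeodesicConstant (n : ℕ) (C : ℝ) : Prop :=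
  0 < C ∧
  ∀ x w : EuclideanSpace ℝ (Fin n), ‖x‖ = 1 → ⟪x, w⟫ = 0 → ‖w‖ ≤ Real.pi →
  ∀ X : ℝ → EuclideanSpace ℝ (Fin n), IsParallelAlong (fun s => sphereExp x (s • w)) X →
  ∀ t : ℝ, 0 ≤ t →
    geoDist (sphereExp x (t • X 0)) (sphereExp (sphereExp x w) (t • X 1)) ≤
      C * geoDist x (sphereExp x w)

end

/-! Convolution with `V` does not expand `W_p` at all, and every admissible constant is at least 1
(`IsGeodesicConstant.one_le`), so the bound holds for each of them. For a pair `(x, y)` there is an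
isometry `R` taking `x` to `y` that moves no point farther than `d(x, y)`
(`inner_le_inner_rotationTo`). Since `V` is zonal and `σ` is invariant, `R` pushes the law `V(·,
x)σ` to `V(·, y)σ`. Averaging the laws of `(z, R z)` over a coupling `π` of `μ` and `ν` therefore
couples `V * μ` with `V * ν` (`convCoupling`), at a cost not exceeding that of `π`. Admissibility of
3 follows from that of 1: an explicit formula for parallel transport along a great circle shows that
the distance never exceeds its initial value. -/

/-! ### Rotations taking one point to another -/

/-- The product of the reflections in the lines spanned by `x` and by `x + y`. For unit vectors
`x` and `y` it maps `x` to `y`; if `x ≠ -y` it is the rotation in the plane of `x` and `y`. -/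
noncomputable def rotationTo {n : ℕ} (x y : EuclideanSpace ℝ (Fin n)) :
    EuclideanSpace ℝ (Fin n) ≃ₗᵢ[ℝ] EuclideanSpace ℝ (Fin n) :=
  (Submodule.reflection (Submodule.span ℝ {x})).trans (Submodule.reflection (Submodule.span ℝ {x + y}))

theorem rotationTo_apply {n : ℕ} (x y z : EuclideanSpace ℝ (Fin n)) :
    rotationTo x y z =
      (2 * (⟪x + y, (2 * (⟪x, z⟫ / ‖x‖ ^ 2)) • x - z⟫ / ‖x + y‖ ^ 2)) • (x + y)
        - ((2 * (⟪x, z⟫ / ‖x‖ ^ 2)) • x - z) := by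
  simp only [rotationTo, LinearIsometryEquiv.trans_apply, Submodule.reflection_singleton_apply,
    mul_smul, two_smul, RCLike.ofReal_real_eq_id, id]

theorem norm_add_sq_of_unit {n : ℕ} {x y : EuclideanSpace ℝ (Fin n)}
    (hx : ‖x‖ = 1) (hy : ‖y‖ = 1) : ‖x + y‖ ^ 2 = 2 * (1 + ⟪x, y⟫) := by
  rw [norm_add_sq_real, hx, hy]; ring

theorem rotationTo_apply_self {n : ℕ} {x y : EuclideanSpace ℝ (Fin n)}
    (hx : ‖x‖ = 1) (hy : ‖y‖ = 1) : rotationTo x y x = y := by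
  have hxx : ⟪x, x⟫ = 1 := by rw [real_inner_self_eq_norm_sq, hx]; norm_num
  rw [rotationTo_apply, norm_add_sq_of_unit hx hy, hx, hxx]
  have h2 : (2 * ((1 : ℝ) / 1 ^ 2)) • x - x = x := by module
  rw [h2, inner_add_left, hxx, real_inner_comm]
  -- In the antipodal case `x + y = 0`, and the second reflection degenerates to `-id`.
  rcases eq_or_ne (1 + ⟪x, y⟫) 0 with h | h
  · have : x + y = 0 := by
      rw [← norm_eq_zero, ← sq_eq_zero_iff, norm_add_sq_of_unit hx hy, h, mul_zero]
    rw [this, smul_zero, zero_sub, eq_neg_of_add_eq_zero_left this, neg_neg]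
  · have : 2 * ((1 + ⟪x, y⟫) / (2 * (1 + ⟪x, y⟫))) = 1 := by field_simp
    rw [this]; module

/-- Cauchy–Schwarz for the components of `y` and `z` orthogonal to `x`; equivalently, the Gram
determinant of `x, y, z` is non-negative. -/
theorem gram_det_nonneg {n : ℕ} {x y z : EuclideanSpace ℝ (Fin n)}
    (hx : ‖x‖ = 1) (hy : ‖y‖ = 1) (hz : ‖z‖ = 1) :
    ⟪x, z⟫ ^ 2 + ⟪y, z⟫ ^ 2 - 2 * ⟪x, z⟫ * ⟪y, z⟫ * ⟪x, y⟫ ≤ 1 - ⟪x, y⟫ ^ 2 := by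
  have h := real_inner_mul_inner_self_le (y - ⟪x, y⟫ • x) (z - ⟪x, z⟫ • x)
  simp only [inner_sub_left, inner_sub_right, inner_smul_left, inner_smul_right,
    real_inner_self_eq_norm_sq, hx, hy, hz, real_inner_comm x y, real_inner_comm x z,
    RCLike.conj_to_real] at h
  nlinarith [h]

/-- The rotation from `x` to `y` moves no point farther than it moves `x`. -/
theorem inner_le_inner_rotationTo {n : ℕ} {x y z : EuclideanSpace ℝ (Fin n)}
    (hx : ‖x‖ = 1) (hy : ‖y‖ = 1) (hz : ‖z‖ = 1) : ⟪x, y⟫ ≤ ⟪z, rotationTo x y z⟫ := by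
  rcases eq_or_ne (1 + ⟪x, y⟫) 0 with h | h
  · have h1 := (abs_le.1 (abs_real_inner_le_norm z (rotationTo x y z))).1
    rw [LinearIsometryEquiv.norm_map, hz] at h1
    linarith
  · have hpos : 0 < 1 + ⟪x, y⟫ := by
      have h1 := (abs_le.1 (abs_real_inner_le_norm x y)).1
      rw [hx, hy] at h1
      exact lt_of_le_of_ne (by linarith) h.symm
    have key : ⟪z, rotationTo x y z⟫ = 1 + 2 * ⟪x, z⟫ * ⟪y, z⟫
        - (⟪x, z⟫ + ⟪y, z⟫) ^ 2 / (1 + ⟪x, y⟫) := by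
      rw [rotationTo_apply, norm_add_sq_of_unit hx hy, hx]
      simp only [inner_sub_right, inner_add_right, inner_add_left, inner_smul_right,
        real_inner_self_eq_norm_sq, hx, hz, real_inner_comm x y, real_inner_comm x z,
        real_inner_comm y z]
      field_simp
      ring
    have hg := gram_det_nonneg hx hy hz
    rw [key, ← sub_nonneg]
    -- The gap is the Gram determinant of `x, y, z` divided by `1 + ⟪x, y⟫`.
    have : 1 + 2 * ⟪x, z⟫ * ⟪y, z⟫ - (⟪x, z⟫ + ⟪y, z⟫) ^ 2 / (1 + ⟪x, y⟫) - ⟪x, y⟫ =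
        (1 - ⟪x, y⟫ ^ 2 - (⟪x, z⟫ ^ 2 + ⟪y, z⟫ ^ 2 - 2 * ⟪x, z⟫ * ⟪y, z⟫ * ⟪x, y⟫))
          / (1 + ⟪x, y⟫) := by
      field_simp
      ring
    rw [this]
    exact div_nonneg (by linarith) hpos.le

/-! ### Invariance of the uniform measure -/

/-- The action of a linear isometry on the unit sphere. -/
noncomputable def sphereMap {n : ℕ} (L : EuclideanSpace ℝ (Fin n) ≃ₗᵢ[ℝ] EuclideanSpace ℝ (Fin n))
    (z : USphere n) : USphere n :=
  ⟨L z, by simp⟩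

theorem continuous_sphereMap {n : ℕ}
    (L : EuclideanSpace ℝ (Fin n) ≃ₗᵢ[ℝ] EuclideanSpace ℝ (Fin n)) :
    Continuous (sphereMap L) :=
  (L.continuous.comp continuous_subtype_val).subtype_mk _

-- The surface measure of `s` is a multiple of the volume of the cone `(0, 1) • s`; `L` carries
-- cones to cones and preserves volume.
open scoped Pointwise in
theorem measurePreserving_sphereMap_toSphere {n : ℕ}
    (L : EuclideanSpace ℝ (Fin n) ≃ₗᵢ[ℝ] EuclideanSpace ℝ (Fin n)) :
    MeasurePreserving (sphereMap L) (volume : Measure (EuclideanSpace ℝ (Fin n))).toSphere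
      (volume : Measure (EuclideanSpace ℝ (Fin n))).toSphere := by
  refine ⟨(continuous_sphereMap L).measurable, ?_⟩
  ext s hs
  have hs' := (continuous_sphereMap L).measurable hs
  rw [Measure.map_apply (continuous_sphereMap L).measurable hs, Measure.toSphere_apply' _ hs,
    Measure.toSphere_apply' _ hs']
  congr 1
  rw [← L.measurePreserving.measure_preimage_equiv (f := L.toMeasurableEquiv)
    (Ioo (0 : ℝ) 1 • (Subtype.val '' s))]
  congr 1
  ext v
  simp only [mem_preimage, Set.mem_smul, mem_image]
  constructor
  · rintro ⟨r, hr, _, ⟨z, hz, rfl⟩, rfl⟩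
    exact ⟨r, hr, L z, ⟨sphereMap L z, hz, rfl⟩, (L.map_smul r _).symm⟩
  · rintro ⟨r, hr, _, ⟨z, hz, rfl⟩, h⟩
    have hL : sphereMap L (sphereMap L.symm z) = z := Subtype.ext (L.apply_symm_apply _)
    refine ⟨r, hr, L.symm z, ⟨sphereMap L.symm z, by rw [hL]; exact hz, rfl⟩, ?_⟩
    apply L.injective
    rw [map_smul, L.apply_symm_apply]
    exact h

theorem measurePreserving_sphereMap {n : ℕ}
    (L : EuclideanSpace ℝ (Fin n) ≃ₗᵢ[ℝ] EuclideanSpace ℝ (Fin n)) :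
    MeasurePreserving (sphereMap L) (sphereUnif n) (sphereUnif n) :=
  (measurePreserving_sphereMap_toSphere L).smul_measure _

instance sphereUnif.instIsFiniteMeasure {n : ℕ} [NeZero n] : IsFiniteMeasure (sphereUnif n) := by
  refine Measure.smul_finite _ (ENNReal.inv_ne_top.2 ?_)
  rw [Ne, Measure.measure_univ_eq_zero]
  exact Measure.toSphere_ne_zero _

/-- Joint measurability lets `convCoupling` be a push-forward. The explicit formula gives it also
across antipodal pairs, where the division by zero yields 0. -/
theorem measurable_sphereMap_rotationTo {n : ℕ} :
    Measurable fun q : (USphere n × USphere n) × USphere n =>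
      sphereMap (rotationTo (q.1.1 : EuclideanSpace ℝ (Fin n)) q.1.2) q.2 := by
  refine Measurable.subtype_mk ?_
  simp only [rotationTo_apply]
  fun_prop

/-! ### Parallel transport and admissible constants -/

section ParallelTransport

variable {n : ℕ}

theorem sphereExp_smul_unit (x e : EuclideanSpace ℝ (Fin n)) (he : ‖e‖ = 1) (r : ℝ) :
    sphereExp x (r • e) = Real.cos r • x + Real.sin r • e := by
  rw [sphereExp, norm_smul, he, mul_one, Real.norm_eq_abs, Real.cos_abs, smul_smul]
  congr 2
  rcases eq_or_ne r 0 with rfl | hr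
  · simp
  · rw [Real.sinc_of_ne_zero (abs_ne_zero.2 hr)]
    rcases abs_cases r with ⟨h, _⟩ | ⟨h, _⟩ <;> rw [h]
    · field_simp
    · rw [Real.sin_neg]; field_simp

theorem sphereExp_zero (x : EuclideanSpace ℝ (Fin n)) : sphereExp x 0 = x := by
  simp [sphereExp]

theorem norm_sphereExp {x v : EuclideanSpace ℝ (Fin n)} (hx : ‖x‖ = 1) (hv : ⟪x, v⟫ = 0) :
    ‖sphereExp x v‖ = 1 := by
  rcases eq_or_ne v 0 with rfl | h
  · rwa [sphereExp_zero]
  · have h0 : ‖v‖ ≠ 0 := norm_ne_zero_iff.2 h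
    have : ‖sphereExp x v‖ ^ 2 = 1 := by
      rw [sphereExp, norm_add_sq_real, norm_smul, norm_smul, inner_smul_left, inner_smul_right, hv,
        hx, mul_pow, mul_pow, Real.norm_eq_abs, Real.norm_eq_abs, sq_abs, sq_abs,
        Real.sinc_of_ne_zero h0, div_pow, div_mul_cancel₀ _ (pow_ne_zero 2 h0)]
      simp
    exact (pow_eq_one_iff_of_nonneg (norm_nonneg _) two_ne_zero).1 this

/-- A function that is continuous on `[0, 1]` and has zero derivative inside has equal values at
the two end points. -/
theorem eq_of_hasDerivAt_zero {f : ℝ → EuclideanSpace ℝ (Fin n)} (hf : ContinuousOn f (Icc 0 1))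
    (hf' : ∀ s ∈ Ioo (0 : ℝ) 1, HasDerivAt f 0 s) : f 1 = f 0 := by
  have h := exists_hasDerivAt_eq_slope (fun s => ⟪f 1 - f 0, f s⟫) (fun _ => 0) zero_lt_one
    (continuousOn_const.inner hf)
    fun s hs => by simpa using (hasDerivAt_const s (f 1 - f 0)).inner ℝ (hf' s hs)
  obtain ⟨-, -, h⟩ := h
  rw [sub_zero, div_one, ← inner_sub_right] at h
  exact sub_eq_zero.1 (inner_self_eq_zero.1 h.symm)

/-- Parallel transport along a great circle through `x` with unit direction `e`. -/
theorem IsParallelAlong.transport {x e : EuclideanSpace ℝ (Fin n)} {θ : ℝ}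
    (hx : ‖x‖ = 1) (he : θ = 0 ∨ ‖e‖ = 1) (hxe : ⟪x, e⟫ = 0) {X : ℝ → EuclideanSpace ℝ (Fin n)}
    (hX : IsParallelAlong (fun s => Real.cos (s * θ) • x + Real.sin (s * θ) • e) X) :
    X 1 = X 0 + ⟪X 0, e⟫ • (-Real.sin θ • x + (Real.cos θ - 1) • e) := by
  obtain ⟨hc, ht, hd⟩ := hX
  set γ : ℝ → EuclideanSpace ℝ (Fin n) :=
    fun s => Real.cos (s * θ) • x + Real.sin (s * θ) • e with hγ
  set τ : ℝ → EuclideanSpace ℝ (Fin n) :=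
    fun s => -Real.sin (s * θ) • x + Real.cos (s * θ) • e with hτ
  have hlin (s : ℝ) : HasDerivAt (fun s : ℝ => s * θ) θ s := by
    simpa using (hasDerivAt_id s).mul_const θ
  have hγ' (s : ℝ) : HasDerivAt γ (θ • τ s) s := by
    refine (((hlin s).cos.smul_const x).add ((hlin s).sin.smul_const e)).congr_deriv ?_
    simp only [hτ]; module
  have hτ' (s : ℝ) : HasDerivAt τ (-θ • γ s) s := by
    refine (((hlin s).sin.neg.smul_const x).add ((hlin s).cos.smul_const e)).congr_deriv ?_
    simp only [hγ]; module
  have hcτ : Continuous τ := continuous_iff_continuousAt.2 fun s => (hτ' s).continuousAt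
  have hγτ (s : ℝ) : ⟪γ s, τ s⟫ = 0 := by
    simp only [hγ, hτ, inner_add_left, inner_add_right, inner_smul_left, inner_smul_right,
      real_inner_self_eq_norm_sq, hx, hxe, real_inner_comm x e, RCLike.conj_to_real]
    rcases he with rfl | he
    · simp
    · rw [he]; ring
  have hpar (s : ℝ) (hs : s ∈ Ioo (0 : ℝ) 1) :
      HasDerivAt X (-(θ * ⟪X s, τ s⟫) • γ s) s := by
    obtain ⟨h1, h2⟩ := hd s hs
    -- Differentiating `⟪γ, X⟫ = 0` determines the normal component of `X'`, which is all of `X'`.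
    have h3 : HasDerivAt (fun s => ⟪γ s, X s⟫) (⟪γ s, deriv X s⟫ + ⟪θ • τ s, X s⟫) s :=
      (hγ' s).inner ℝ h1.hasDerivAt
    have h4 : HasDerivAt (fun s => ⟪γ s, X s⟫) 0 s := by
      refine (hasDerivAt_const s (0 : ℝ)).congr_of_eventuallyEq ?_
      filter_upwards [Icc_mem_nhds hs.1 hs.2] with r hr using ht r hr
    have h5 := h3.unique h4
    rw [inner_smul_left, real_inner_comm (X s), RCLike.conj_to_real] at h5
    rw [sub_eq_zero] at h2
    have h6 := h1.hasDerivAt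
    rw [h2] at h6
    refine h6.congr_deriv ?_
    rw [show ⟪γ s, deriv X s⟫ = -(θ * ⟪X s, τ s⟫) by linarith]
  have hpair (s : ℝ) (hs : s ∈ Ioo (0 : ℝ) 1) : HasDerivAt (fun s => ⟪X s, τ s⟫) 0 s := by
    refine ((hpar s hs).inner ℝ (hτ' s)).congr_deriv ?_
    rw [inner_smul_right, inner_smul_left, hγτ, real_inner_comm,
      ht s (Ioo_subset_Icc_self hs)]
    simp
  have hcp : ContinuousOn (fun s => ⟪X s, τ s⟫) (Icc 0 1) := hc.inner hcτ.continuousOn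
  -- `⟪X, τ⟫` is constant and `τ' = -θ γ`, so `X` and `⟪X, τ⟫ τ` have the same derivative.
  have key := eq_of_hasDerivAt_zero (f := fun s => X s - ⟪X s, τ s⟫ • τ s)
    (hc.sub (hcp.smul hcτ.continuousOn)) fun s hs => by
      refine ((hpar s hs).sub ((hpair s hs).smul (hτ' s))).congr_deriv ?_
      module
  have hconst : ⟪X 1, τ 1⟫ = ⟪X 0, τ 0⟫ := by
    obtain ⟨-, -, h⟩ := exists_hasDerivAt_eq_slope (fun s => ⟪X s, τ s⟫) (fun _ => 0) zero_lt_one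
      hcp hpair
    rw [sub_zero, div_one] at h
    linarith
  have hτ0 : τ 0 = e := by simp [hτ]
  have hτ1 : τ 1 = -Real.sin θ • x + Real.cos θ • e := by simp [hτ]
  simp only [hconst] at key
  rw [hτ0, hτ1, sub_eq_iff_eq_add] at key
  rw [key]
  module

end ParallelTransport

/-- Along a minimizing great circle, parallel transport is the restriction of a rotation that moves
no point farther than the base point; so geodesics with parallel initial velocities never get
farther apart than their starting points. -/
theorem isGeodesicConstant_one (n : ℕ) : IsGeodesicConstant n 1 := by
  refine ⟨one_pos, fun x w hx hxw _ X hX t _ => ?_⟩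
  rw [one_mul]
  -- For `w = 0` the choice `e = 0` serves, so no unit tangent vector is needed; hence the
  -- disjunction.
  obtain ⟨e, he, hwe, hxe⟩ : ∃ e : EuclideanSpace ℝ (Fin n),
      (‖w‖ = 0 ∨ ‖e‖ = 1) ∧ w = ‖w‖ • e ∧ ⟪x, e⟫ = 0 := by
    rcases eq_or_ne w 0 with rfl | h
    · exact ⟨0, by simp⟩
    · have h0 := norm_ne_zero_iff.2 h
      exact ⟨‖w‖⁻¹ • w, Or.inr (norm_smul_inv_norm h), by rw [smul_inv_smul₀ h0],
        by rw [inner_smul_right, hxw, mul_zero]⟩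
  set θ := ‖w‖
  have hexp (s : ℝ) : sphereExp x (s • w) = Real.cos (s * θ) • x + Real.sin (s * θ) • e := by
    rcases he with h | h
    · rw [hwe, h]; simp [sphereExp]
    · rw [hwe, smul_smul, sphereExp_smul_unit x e h]
  simp only [hexp] at hX
  have hX1 := hX.transport hx he hxe
  have hy : sphereExp x w = Real.cos θ • x + Real.sin θ • e := by
    simpa using hexp 1
  have hxv : ⟪x, X 0⟫ = 0 := by simpa using hX.2.1 0 (by simp)
  rw [hy, hX1]
  set v := X 0
  have hxx : ⟪x, x⟫ = 1 := by rw [real_inner_self_eq_norm_sq, hx, one_pow]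
  have hcos : (Real.cos θ - 1) * ⟪e, e⟫ = Real.cos θ - 1 := by
    rcases he with h | h
    · simp [h]
    · rw [real_inner_self_eq_norm_sq, h]; ring
  have hbase : ⟪x, Real.cos θ • x + Real.sin θ • e⟫ = Real.cos θ := by
    rw [inner_add_right, inner_smul_right, inner_smul_right, hxx, hxe]; ring
  have hnorm : ‖v + ⟪v, e⟫ • (-Real.sin θ • x + (Real.cos θ - 1) • e)‖ = ‖v‖ := by
    rw [← sq_eq_sq₀ (norm_nonneg _) (norm_nonneg _), ← real_inner_self_eq_norm_sq,
      ← real_inner_self_eq_norm_sq]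
    simp only [inner_add_left, inner_add_right, inner_smul_left, inner_smul_right, hxx, hxe, hxv,
      real_inner_comm x e, real_inner_comm x v, real_inner_comm v e, RCLike.conj_to_real]
    linear_combination (⟪v, e⟫ ^ 2 * (Real.cos θ - 1)) * hcos
      + ⟪v, e⟫ ^ 2 * Real.sin_sq_add_cos_sq θ
  have hunit : ‖sphereExp x (t • v)‖ = 1 :=
    norm_sphereExp hx (by rw [inner_smul_right, hxv, mul_zero])
  set q := Real.sinc ‖t • v‖ * t
  set c := Real.cos ‖t • v‖
  have hz : sphereExp x (t • v) = c • x + q • v := by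
    rw [sphereExp, smul_smul]
  have hz' : sphereExp (Real.cos θ • x + Real.sin θ • e)
      (t • (v + ⟪v, e⟫ • (-Real.sin θ • x + (Real.cos θ - 1) • e))) =
      c • (Real.cos θ • x + Real.sin θ • e)
        + q • (v + ⟪v, e⟫ • (-Real.sin θ • x + (Real.cos θ - 1) • e)) := by
    rw [sphereExp, smul_smul, norm_smul, hnorm, ← norm_smul]
  have hone : c ^ 2 + q ^ 2 * ⟪v, v⟫ = 1 := by
    rw [hz, ← sq_eq_sq₀ (norm_nonneg _) zero_le_one, ← real_inner_self_eq_norm_sq] at hunit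
    simp only [inner_add_left, inner_add_right, inner_smul_left, inner_smul_right, hxx, hxv,
      real_inner_comm x v, RCLike.conj_to_real] at hunit
    linarith
  have hbessel : ⟪v, e⟫ ^ 2 * (1 - Real.cos θ) ≤ ⟪v, v⟫ * (1 - Real.cos θ) := by
    rcases he with h | h
    · simp [h]
    · refine mul_le_mul_of_nonneg_right ?_ (sub_nonneg.2 (Real.cos_le_one θ))
      have := real_inner_mul_inner_self_le v e
      rwa [real_inner_self_eq_norm_sq e, h, one_pow, mul_one, ← sq] at this
  rw [hz, hz', geoDist, geoDist, hbase]
  refine Real.arccos_le_arccos ?_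
  simp only [inner_add_left, inner_add_right, inner_smul_left, inner_smul_right, hxx, hxe, hxv,
    real_inner_comm x v, RCLike.conj_to_real]
  -- The inner product of the end points exceeds `cos θ` by `q² (1 - cos θ) (‖v‖² - ⟪v, e⟫²)`.
  linear_combination mul_le_mul_of_nonneg_left hbessel (sq_nonneg q) - Real.cos θ * hone

/-- An admissible constant is at least `1`: compare two constant geodesics. -/
theorem IsGeodesicConstant.one_le {n : ℕ} (hn : 2 ≤ n) {C : ℝ} (hC : IsGeodesicConstant n C) :
    1 ≤ C := by
  have h01 : (⟨0, by omega⟩ : Fin n) ≠ ⟨1, by omega⟩ := by simp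
  set x : EuclideanSpace ℝ (Fin n) := EuclideanSpace.single ⟨0, by omega⟩ 1
  set e : EuclideanSpace ℝ (Fin n) := EuclideanSpace.single ⟨1, by omega⟩ 1
  have hx : ‖x‖ = 1 := by simp [x]
  have he : ‖e‖ = 1 := by simp [e]
  have hxe : ⟪x, e⟫ = 0 := by
    simp only [x, e]
    rw [EuclideanSpace.inner_single_left, PiLp.single_apply, if_neg h01, mul_zero]
  -- Along a quarter circle with the zero field, the inequality reads `π/2 ≤ C * (π/2)`.
  have h := hC.2 x ((Real.pi / 2) • e) hx (by rw [inner_smul_right, hxe, mul_zero])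
    (by rw [norm_smul, he, Real.norm_of_nonneg (by positivity)]; linarith [Real.pi_pos])
    (fun _ => 0) ⟨continuousOn_const, by simp, by simp⟩ 0 le_rfl
  rw [smul_zero, sphereExp_zero, sphereExp_zero, sphereExp_smul_unit x e he] at h
  simp only [geoDist, Real.cos_pi_div_two, Real.sin_pi_div_two, zero_smul, one_smul, zero_add, hxe,
    Real.arccos_zero] at h
  have := Real.pi_pos
  nlinarith

theorem IsGeodesicConstant.mono {n : ℕ} {C C' : ℝ} (hC : IsGeodesicConstant n C) (h : C ≤ C') :
    IsGeodesicConstant n C' :=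
  ⟨hC.1.trans_le h, fun x w hx hxw hw X hX t ht => (hC.2 x w hx hxw hw X hX t ht).trans
    (mul_le_mul_of_nonneg_right h (Real.arccos_nonneg _))⟩

/-! ### Zonal kernels and the coupling of convolutions -/

section Convolution

variable {n : ℕ} {V : USphere n → USphere n → ℝ}

theorem IsZonal.apply_sphereMap (hV : IsZonal V)
    (L : EuclideanSpace ℝ (Fin n) ≃ₗᵢ[ℝ] EuclideanSpace ℝ (Fin n)) (x y : USphere n) :
    V (sphereMap L x) (sphereMap L y) = V x y := by
  obtain ⟨f, hf⟩ := hV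
  rw [hf, hf]
  exact congrArg f (L.inner_map_map _ _)

theorem IsZonal.symm (hV : IsZonal V) (x y : USphere n) : V x y = V y x := by
  obtain ⟨f, hf⟩ := hV
  rw [hf, hf, real_inner_comm]

theorem sphereMap_rotationTo_self (x y : USphere n) :
    sphereMap (rotationTo (x : EuclideanSpace ℝ (Fin n)) y) x = y :=
  Subtype.ext (rotationTo_apply_self (by simp) (by simp))

theorem geoDist_rotationTo_le (x y z : USphere n) :
    geoDist (z : EuclideanSpace ℝ (Fin n))
      (sphereMap (rotationTo (x : EuclideanSpace ℝ (Fin n)) y) z) ≤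
      geoDist (x : EuclideanSpace ℝ (Fin n)) y :=
  Real.arccos_le_arccos (inner_le_inner_rotationTo (by simp) (by simp) (by simp))

/-- Rotating the sphere carries the kernel centred at `x` to the kernel centred at `y`. -/
theorem IsZonal.lintegral_rotationTo (hV : IsZonal V) (hVmeas : Measurable (Function.uncurry V))
    {f : USphere n → ℝ≥0∞} (hf : Measurable f) (x y : USphere n) :
    ∫⁻ z, f (sphereMap (rotationTo (x : EuclideanSpace ℝ (Fin n)) y) z) * ENNReal.ofReal (V z x)
        ∂sphereUnif n =
      ∫⁻ z, f z * ENNReal.ofReal (V z y) ∂sphereUnif n := by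
  have hm : Measurable fun z => f z * ENNReal.ofReal (V z y) :=
    hf.mul (hVmeas.comp measurable_prodMk_right).ennreal_ofReal
  rw [← (measurePreserving_sphereMap (rotationTo (x : EuclideanSpace ℝ (Fin n)) y)).lintegral_comp
    hm]
  refine lintegral_congr fun z => ?_
  -- Only the centre `y` is rewritten as the image of `x`, so that both arguments of `V` are
  -- rotated.
  nth_rw 4 [← sphereMap_rotationTo_self x y]
  rw [hV.apply_sphereMap]

theorem IsZonal.lintegral_eq_one (hV : IsZonal V) (hVmeas : Measurable (Function.uncurry V))
    (hVnonneg : ∀ x y, 0 ≤ V x y) {x₀ : USphere n} (hVmass : ∫ x, V x₀ x ∂(sphereUnif n) = 1)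
    (x : USphere n) : ∫⁻ z, ENNReal.ofReal (V z x) ∂sphereUnif n = 1 := by
  have h0 : ∫⁻ z, ENNReal.ofReal (V z x₀) ∂sphereUnif n = 1 := by
    have hint : Integrable (V x₀) (sphereUnif n) := by
      by_contra h
      rw [integral_undef h] at hVmass
      exact zero_ne_one hVmass
    simp_rw [hV.symm _ x₀]
    rw [← ofReal_integral_eq_lintegral_ofReal hint (.of_forall (hVnonneg x₀)), hVmass,
      ENNReal.ofReal_one]
  rw [← h0]
  simpa using (hV.lintegral_rotationTo hVmeas (f := 1) measurable_one x₀ x).symm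

variable [NeZero n]

/-- The coupling of `V * μ` and `V * ν` obtained from a coupling `π` of `μ` and `ν`:
choose `(x, y)` with law `π`, then `z` with density `V(·, x)`, and pair `z` with its image under the
rotation from `x` to `y`. -/
noncomputable def convCoupling (V : USphere n → USphere n → ℝ)
    (π : Measure (USphere n × USphere n)) : Measure (USphere n × USphere n) :=
  ((π.prod (sphereUnif n)).withDensity fun q => ENNReal.ofReal (V q.2 q.1.1)).map fun q =>
    (q.2, sphereMap (rotationTo (q.1.1 : EuclideanSpace ℝ (Fin n)) q.1.2) q.2)

theorem lintegral_convCoupling (hVmeas : Measurable (Function.uncurry V))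
    (π : Measure (USphere n × USphere n)) {f : USphere n × USphere n → ℝ≥0∞}
    (hf : Measurable f) :
    ∫⁻ z, f z ∂convCoupling V π = ∫⁻ q, ∫⁻ z,
      f (z, sphereMap (rotationTo (q.1 : EuclideanSpace ℝ (Fin n)) q.2) z)
        * ENNReal.ofReal (V z q.1) ∂sphereUnif n ∂π := by
  have hR : Measurable fun q : (USphere n × USphere n) × USphere n =>
      (q.2, sphereMap (rotationTo (q.1.1 : EuclideanSpace ℝ (Fin n)) q.1.2) q.2) :=
    measurable_snd.prodMk measurable_sphereMap_rotationTo
  have hd : Measurable fun q : (USphere n × USphere n) × USphere n =>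
      ENNReal.ofReal (V q.2 q.1.1) :=
    (hVmeas.comp (measurable_snd.prodMk (measurable_fst.comp measurable_fst))).ennreal_ofReal
  rw [convCoupling, lintegral_map hf hR,
    lintegral_withDensity_eq_lintegral_mul _ hd (hf.fun_comp hR),
    lintegral_prod _ (hd.mul (hf.fun_comp hR)).aemeasurable]
  simp only [Pi.mul_apply, mul_comm]

/-- By Tonelli, `V * μ` is the `μ`-mixture of the laws `V(·, x)σ`; marginals of `convCoupling` are
compared in this form. -/
theorem lintegral_sphereConv (hVmeas : Measurable (Function.uncurry V))
    (μ : Measure (USphere n)) [IsProbabilityMeasure μ] {f : USphere n → ℝ≥0∞}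
    (hf : Measurable f) :
    ∫⁻ z, f z ∂sphereConv V μ =
      ∫⁻ x, ∫⁻ z, f z * ENNReal.ofReal (V z x) ∂sphereUnif n ∂μ := by
  have hd : Measurable fun x => ∫⁻ y, ENNReal.ofReal (V x y) ∂μ :=
    hVmeas.ennreal_ofReal.lintegral_prod_right'
  rw [sphereConv, lintegral_withDensity_eq_lintegral_mul _ hd hf, lintegral_lintegral_swap]
  · refine lintegral_congr fun z => ?_
    rw [Pi.mul_apply, mul_comm, lintegral_const_mul]
    exact (hVmeas.comp measurable_prodMk_left).ennreal_ofReal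
  · exact ((hf.comp measurable_snd).mul
      (hVmeas.comp measurable_swap).ennreal_ofReal).aemeasurable

theorem convCoupling_mem_couplings (hV : IsZonal V) (hVmeas : Measurable (Function.uncurry V))
    (hmass : ∀ x, ∫⁻ z, ENNReal.ofReal (V z x) ∂sphereUnif n = 1)
    {μ ν : Measure (USphere n)} [IsProbabilityMeasure μ] [IsProbabilityMeasure ν]
    {π : Measure (USphere n × USphere n)} (hπ : π ∈ couplings μ ν) :
    convCoupling V π ∈ couplings (sphereConv V μ) (sphereConv V ν) := by
  obtain ⟨hprob, hfst, hsnd⟩ := hπ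
  have hdens {f : USphere n → ℝ≥0∞} (hf : Measurable f) :
      Measurable fun x => ∫⁻ z, f z * ENNReal.ofReal (V z x) ∂sphereUnif n :=
    ((hf.comp measurable_snd).mul
      (hVmeas.comp measurable_swap).ennreal_ofReal).lintegral_prod_right'
  refine ⟨⟨?_⟩, ?_, ?_⟩
  · rw [← lintegral_one, lintegral_convCoupling hVmeas π measurable_const]
    simp [hmass]
  · refine Measure.ext_of_lintegral _ fun f hf => ?_
    rw [lintegral_map hf measurable_fst,
      lintegral_convCoupling hVmeas π (f := fun z => f z.1) (hf.comp measurable_fst),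
      lintegral_sphereConv hVmeas μ hf, ← hfst, lintegral_map (hdens hf) measurable_fst]
  · refine Measure.ext_of_lintegral _ fun f hf => ?_
    rw [lintegral_map hf measurable_snd,
      lintegral_convCoupling hVmeas π (f := fun z => f z.2) (hf.comp measurable_snd),
      lintegral_sphereConv hVmeas ν hf, ← hsnd, lintegral_map (hdens hf) measurable_snd]
    exact lintegral_congr fun q => hV.lintegral_rotationTo hVmeas hf q.1 q.2

/-- Convolution with a zonal probability kernel does not increase the Wasserstein distance. -/
theorem wassersteinDist_sphereConv_le {p : ℝ} (hp : 0 ≤ p) (hV : IsZonal V)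
    (hVmeas : Measurable (Function.uncurry V))
    (hmass : ∀ x, ∫⁻ z, ENNReal.ofReal (V z x) ∂sphereUnif n = 1)
    (μ ν : Measure (USphere n)) [IsProbabilityMeasure μ] [IsProbabilityMeasure ν] :
    wassersteinDist p (sphereConv V μ) (sphereConv V ν) ≤ wassersteinDist p μ ν := by
  refine le_iInf₂ fun π hπ => (iInf₂_le _ (convCoupling_mem_couplings hV hVmeas hmass hπ)).trans ?_
  refine ENNReal.rpow_le_rpow ?_ (by positivity)
  have hcost : Measurable fun z : USphere n × USphere n =>
      ENNReal.ofReal (geoDist (z.1 : EuclideanSpace ℝ (Fin n)) z.2) ^ p := by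
    refine Measurable.pow_const (Measurable.ennreal_ofReal ?_) p
    unfold geoDist
    exact Real.continuous_arccos.measurable.comp (by fun_prop)
  rw [lintegral_convCoupling hVmeas π hcost]
  -- For fixed `(x, y)` the cost is at most `d(x, y)^p` uniformly in `z`, and the law of `z` has
  -- mass 1.
  refine lintegral_mono fun q => ?_
  calc _ ≤ ∫⁻ z, ENNReal.ofReal (geoDist (q.1 : EuclideanSpace ℝ (Fin n)) q.2) ^ p
          * ENNReal.ofReal (V z q.1) ∂sphereUnif n :=
        lintegral_mono fun z => mul_le_mul_left (ENNReal.rpow_le_rpow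
          (ENNReal.ofReal_le_ofReal (geoDist_rotationTo_le q.1 q.2 z)) hp) _
    _ = _ := by
        have hm : Measurable fun z => ENNReal.ofReal (V z q.1) :=
          (hVmeas.comp measurable_prodMk_right).ennreal_ofReal
        rw [lintegral_const_mul _ hm, hmass, mul_one]

end Convolution

theorem lemma3p1 (n : ℕ) (hn : 2 ≤ n) (p : ℝ) (hp : 1 ≤ p)
    (V : USphere n → USphere n → ℝ) (hVmeas : Measurable (Function.uncurry V))
    (hVzonal : IsZonal V) (hVnonneg : ∀ x y, 0 ≤ V x y)
    (x₀ : USphere n) (hVmass : ∫ x, V x₀ x ∂(sphereUnif n) = 1)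
    (μ ν : Measure (USphere n)) [IsProbabilityMeasure μ] [IsProbabilityMeasure ν] :
    IsGeodesicConstant n 3 ∧
    wassersteinDist p (sphereConv V μ) (sphereConv V ν) ≤ 3 * wassersteinDist p μ ν ∧
    ∀ C₀ : ℝ, IsGeodesicConstant n C₀ →
      wassersteinDist p (sphereConv V μ) (sphereConv V ν) ≤
        ENNReal.ofReal C₀ * wassersteinDist p μ ν := by
  have : NeZero n := ⟨by omega⟩
  have hmass := hVzonal.lintegral_eq_one hVmeas hVnonneg hVmass
  have hW := wassersteinDist_sphereConv_le (zero_le_one.trans hp) hVzonal hVmeas hmass μ ν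
  have hle {c : ℝ≥0∞} (hc : 1 ≤ c) : wassersteinDist p (sphereConv V μ) (sphereConv V ν) ≤
      c * wassersteinDist p μ ν :=
    hW.trans (le_mul_of_one_le_left' hc)
  exact ⟨(isGeodesicConstant_one n).mono (by norm_num), hle (by norm_num),
    fun C₀ hC => hle (ENNReal.one_le_ofReal.2 (hC.one_le hn))⟩
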